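/- For a group $G$, let $\mathcal I(G)$ denote the inclusion graph of subgroups of $G$: its vertices are the subgroups $H$ of $G$ with $H\neq\{1\}$ and $H\neq G$, and two distinct vertices $H,K$ are adjacent if and only if $H\subset K$ or $K\subset H$. Let $Q_8=\langle a,b\mid a^4=b^4=1,\ a^2=b^2,\ ab=ba^{-1}\rangle$ be the quaternion group of order $8$, let $M_8=\langle a,b\mid a^4=b^2=1,\ ab=ba^{-1}\rangle$ be the dihedral group of order $8$, and let $\mathbb Z_9\rtimes\mathbb Z_2=\langle a,b\mid a^9=b^2=1,\ bab^{-1}=a^i\rangle$ with $i$ of multiplicative order $2$ modulo $9$, that is, the semidirect product of $\mathbb Z_9$ by $\mathbb Z_2$ for the (unique) nontrivial action. Let $G$ be a group. Then: 1. if $\mathcal I(G)\cong\mathcal I(Q_8)$ as graphs, then $G\cong Q_8$; 2. if $\mathcal I(G)\cong\mathcal I(M_8)$ as graphs, then $G\cong M_8$; 3. if $\mathcal I(G)\cong\mathcal I(\mathbb Z_9\rtimes\mathbb Z_2)$ as graphs, then $G\cong\mathbb Z_9\rtimes\mathbb Z_2$. -/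

import Mathlib

/-- The inclusion graph `𝓘(G)` of subgroups of a group `G`: the vertices are the subgroups of `G`
other than the trivial subgroup and `G` itself; two vertices are adjacent iff one of them is
strictly contained in the other. -/
def inclusionGraph (G : Type*) [Group G] :
    SimpleGraph {H : Subgroup G // H ≠ ⊥ ∧ H ≠ ⊤} where
  Adj H K := H.1 < K.1 ∨ K.1 < H.1
  symm := ⟨fun _ _ h => h.symm⟩
  loopless := ⟨fun _ h => h.elim (lt_irrefl _) (lt_irrefl _)⟩

/-- `Q₈ = ⟨a, b ∣ a⁴ = b⁴ = 1, a² = b², ab = ba⁻¹⟩`, the quaternion group of order 8. -/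
abbrev Q8 : Type := QuaternionGroup 2

/-- `M₈ = ⟨a, b ∣ a⁴ = b² = 1, ab = ba⁻¹⟩`, the dihedral group of order 8
(`a` is the rotation `r 1` and `b` the reflection `sr 0`). -/
abbrev M8 : Type := DihedralGroup 4

/-! The graph tells which subgroups are comparable but not which is the larger, so a diagram keeps
only comparability. The semidirect product is the dihedral group of order 18. For it and for `M8`
the graph is a tree, for `Q8` a star with three edges. In a connected graph without triangles,
transitivity lets one oriented edge orient all others, so the subgroup order of `G` is the model
order or its dual. A finite graph also forces `G` to be finite.

Tree, model order (`dihedral_of_below`): the `leaf` subgroup A is characteristic because the order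
alone singles it out. The κ `tip` subgroups are complements of A, of a common prime order q, and
cover all elements outside A; counting gives |A| = κ = p². Moreover A is cyclic, and y ^ q = 1 for
every y outside A. Using this for x and for ax, where a generates A, forces q = 2 and x a x⁻¹ = a⁻¹.
Dual order (`not_below_swap`): now A has prime order, and counting again gives |A| = κ = p², which
is absurd.

Star, model order: the least subgroup has prime order l, the three others are cyclic of order l²,
and counting forces l = 2; the quaternion relations follow since there is only one involution. Dual
order: `G` would be cyclic and yet have distinct subgroups of equal order. -/

/-- `S` enumerates the proper nontrivial subgroups of `G`, with comparability given by `r`. -/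
structure IsSubgroupDiagram {G T : Type*} [Group G] (r : T → T → Prop) (S : T → Subgroup G) :
    Prop where
  injective : Function.Injective S
  range_iff : ∀ H : Subgroup G, (H ≠ ⊥ ∧ H ≠ ⊤) ↔ ∃ t, S t = H
  comparable_iff : ∀ s t, (S s < S t ∨ S t < S s) ↔ (r s t ∨ r t s)

theorem IsSubgroupDiagram.transport {G D T : Type*} [Group G] [Group D] {r : T → T → Prop}
    {S : T → Subgroup D} (h : IsSubgroupDiagram r S) (e : inclusionGraph G ≃g inclusionGraph D) :
    ∃ S' : T → Subgroup G, IsSubgroupDiagram r S' := by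
  have hS : ∀ t, S t ≠ ⊥ ∧ S t ≠ ⊤ := fun t => (h.range_iff _).2 ⟨t, rfl⟩
  refine ⟨fun t => (e.symm ⟨S t, hS t⟩).1, ⟨?_, ?_, ?_⟩⟩
  · intro s t hst
    have h1 := e.symm.injective (Subtype.ext hst)
    exact h.injective (congrArg Subtype.val h1)
  · intro H
    constructor
    · intro hH
      obtain ⟨t, ht⟩ := (h.range_iff _).1 (e ⟨H, hH⟩).2
      refine ⟨t, ?_⟩
      have h1 : (⟨S t, hS t⟩ : {H : Subgroup D // H ≠ ⊥ ∧ H ≠ ⊤}) = e ⟨H, hH⟩ := Subtype.ext ht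
      simp [h1]
    · rintro ⟨t, rfl⟩
      exact (e.symm ⟨S t, hS t⟩).2
  · intro s t
    rw [← h.comparable_iff]
    exact e.symm.map_rel_iff (a := ⟨S s, hS s⟩) (b := ⟨S t, hS t⟩)

theorem IsSubgroupDiagram.map_mulEquiv {G D T : Type*} [Group G] [Group D] {r : T → T → Prop}
    {S : T → Subgroup D} (h : IsSubgroupDiagram r S) (e : D ≃* G) :
    IsSubgroupDiagram r (fun t => e.mapSubgroup (S t)) := by
  refine ⟨fun s t hst => h.injective (e.mapSubgroup.injective hst), fun H => ?_, fun s t => ?_⟩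
  · have h1 := h.range_iff (e.mapSubgroup.symm H)
    constructor
    · rintro ⟨h2, h3⟩
      obtain ⟨t, ht⟩ := h1.1 ⟨(map_eq_bot_iff e.mapSubgroup.symm).not.2 h2,
        (map_eq_top_iff e.mapSubgroup.symm).not.2 h3⟩
      exact ⟨t, by rw [ht]; exact e.mapSubgroup.apply_symm_apply H⟩
    · rintro ⟨t, rfl⟩
      have h2 := (h.range_iff _).2 ⟨t, rfl⟩
      exact ⟨(map_eq_bot_iff e.mapSubgroup).not.2 h2.1, (map_eq_top_iff e.mapSubgroup).not.2 h2.2⟩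
  · rw [← h.comparable_iff, OrderIso.lt_iff_lt, OrderIso.lt_iff_lt]

/-! ### Finiteness from finitely many subgroups -/

theorem finite_zpowers_of_finite_subgroups {G : Type*} [Group G] [Finite (Subgroup G)] (x : G) :
    Finite (Subgroup.zpowers x) := by
  by_contra hx
  have h0 : orderOf x = 0 := by
    rw [← Nat.card_zpowers]
    exact Nat.card_eq_zero.2 (Or.inr (not_finite_iff_infinite.1 hx))
  -- If x had infinite order, the subgroups generated by its powers would be pairwise distinct.
  have hinj : Function.Injective (fun n : ℕ => Subgroup.zpowers (x ^ n)) := by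
    have key : ∀ m n : ℕ, Subgroup.zpowers (x ^ m) ≤ Subgroup.zpowers (x ^ n) → n ∣ m := by
      intro m n h
      obtain ⟨k, hk⟩ := Subgroup.mem_zpowers_iff.1 (h (Subgroup.mem_zpowers _))
      rw [← zpow_natCast, ← zpow_natCast, ← zpow_mul] at hk
      have h1 := (injective_zpow_iff_not_isOfFinOrder.2 (orderOf_eq_zero_iff.1 h0)) hk
      exact Int.natCast_dvd_natCast.1 ⟨k, h1.symm⟩
    intro m n h
    exact Nat.dvd_antisymm (key n m h.ge) (key m n h.le)
  exact not_injective_infinite_finite _ hinj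

/-- The group is a union of finitely many finite cyclic subgroups. -/
theorem finite_of_finite_subgroups {G : Type*} [Group G] [Finite (Subgroup G)] : Finite G := by
  have h : (Set.univ : Set G) ⊆ ⋃ H ∈ {H : Subgroup G | Finite H}, (H : Set G) := fun x _ => by
    simp only [Set.mem_iUnion]
    exact ⟨_, finite_zpowers_of_finite_subgroups x, Subgroup.mem_zpowers x⟩
  refine Set.finite_univ_iff.1 (Set.Finite.subset (Set.Finite.biUnion (Set.toFinite _) ?_) h)
  intro H hH
  have : Finite H := hH
  exact Set.toFinite _

theorem IsSubgroupDiagram.finite {G T : Type*} [Group G] [Finite T] {r : T → T → Prop}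
    {S : T → Subgroup G} (h : IsSubgroupDiagram r S) : Finite G := by
  have : Finite (Subgroup G) := by
    have h1 : (Set.univ : Set (Subgroup G)) ⊆ Set.range S ∪ {⊥, ⊤} := fun H _ => by
      by_cases hH : H ≠ ⊥ ∧ H ≠ ⊤
      · exact Or.inl ((h.range_iff H).1 hH)
      · right
        simp only [Set.mem_insert_iff, Set.mem_singleton_iff]
        tauto
    exact Set.finite_univ_iff.1 (((Set.finite_range S).union (Set.toFinite _)).subset h1)
  exact finite_of_finite_subgroups

/-! ### Orders of subgroups and counting -/

theorem Subgroup.card_sup_of_inf_eq_bot {G : Type*} [Group G] (A V : Subgroup G) [A.Normal]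
    (h : A ⊓ V = ⊥) : Nat.card (A ⊔ V : Subgroup G) = Nat.card A * Nat.card V := by
  have h1 := Subgroup.relIndex_mul_relIndex ⊥ A (A ⊔ V) bot_le le_sup_left
  rw [Subgroup.relIndex_sup_left, ← Subgroup.inf_relIndex_right A V, h] at h1
  simpa using h1.symm

/-- A subgroup of order c of a cyclic group consists of elements killed by c, so it lies in the
subgroup generated by `x ^ (orderOf x / c)`, which itself has order c. Below, this is the test
showing that a subgroup is not cyclic. -/
theorem Subgroup.eq_of_card_eq_of_le_zpowers {G : Type*} [Group G] [Finite G] {x : G}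
    {H K : Subgroup G} (hH : H ≤ zpowers x) (hK : K ≤ zpowers x) (h : Nat.card H = Nat.card K) :
    H = K := by
  classical
  have key : ∀ L : Subgroup G, L ≤ zpowers x → Nat.card L = Nat.card H →
      L = zpowers (x ^ (orderOf x / Nat.card H)) := by
    intro L hL hc
    obtain ⟨d, hd⟩ : Nat.card H ∣ orderOf x := by
      rw [← hc, ← Nat.card_zpowers]; exact Subgroup.card_dvd_of_le hL
    have hpos : 0 < Nat.card H := Nat.card_pos
    have hx : 0 < orderOf x := orderOf_pos x
    have hd0 : 0 < d := Nat.pos_of_ne_zero (by rintro rfl; rw [mul_zero] at hd; omega)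
    have hdiv : orderOf x / Nat.card H = d := by rw [hd]; exact Nat.mul_div_cancel_left d hpos
    rw [hdiv]
    refine Subgroup.eq_of_le_of_card_ge ?_ ?_
    · intro y hy
      obtain ⟨k, rfl⟩ := Subgroup.mem_zpowers_iff.1 (hL hy)
      have h1 : (x ^ k) ^ Nat.card H = 1 := by
        rw [← hc]
        exact congrArg Subtype.val (pow_card_eq_one' (x := (⟨x ^ k, hy⟩ : L)))
      rw [← zpow_natCast, ← zpow_mul, ← orderOf_dvd_iff_zpow_eq_one, hd] at h1
      push_cast at h1
      rw [mul_comm k] at h1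
      obtain ⟨c, rfl⟩ := Int.dvd_of_mul_dvd_mul_left (by exact_mod_cast hpos.ne') h1
      refine Subgroup.mem_zpowers_iff.2 ⟨c, ?_⟩
      rw [← zpow_natCast, ← zpow_mul]
    · rw [Nat.card_zpowers, orderOf_pow_of_dvd hd0.ne' ⟨_, by rw [hd, mul_comm]⟩, hc, hd,
        Nat.mul_div_cancel _ hd0]
  rw [key H hH rfl, key K hK h.symm]

/-- By Cauchy, a minimal subgroup is generated by an element of prime order. -/
theorem Subgroup.card_prime_of_forall_lt_eq_bot {G : Type*} [Group G] [Finite G] {H : Subgroup G}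
    (h : H ≠ ⊥) (hmin : ∀ K, K < H → K = ⊥) : (Nat.card H).Prime := by
  have h1 : Nat.card H ≠ 1 := by rwa [Ne, Subgroup.card_eq_one]
  obtain ⟨p, hp, hpH⟩ := Nat.exists_prime_and_dvd h1
  have := Fact.mk hp
  obtain ⟨x, hx⟩ := exists_prime_orderOf_dvd_card' (G := H) p hpH
  have hle : zpowers (x : G) ≤ H := by simp
  rcases hle.lt_or_eq with hlt | heq
  · have := hmin _ hlt
    rw [Subgroup.zpowers_eq_bot] at this
    have hx1 : x = 1 := Subtype.ext this
    rw [hx1, orderOf_one] at hx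
    exact absurd hx.symm hp.ne_one
  · rw [← heq, Nat.card_zpowers, Subgroup.orderOf_coe, hx]
    exact hp

/-- Counting elements outside `N` covered by a family of subgroups meeting pairwise in `N`. -/
theorem Subgroup.card_add_mul_card_eq {G ι : Type*} [Group G] [Finite G] [Finite ι]
    (N : Subgroup G) (W : ι → Subgroup G) {m v : ℕ} (hcov : ∀ x, x ∉ N → ∃ i, x ∈ W i)
    (hdisj : ∀ i j, i ≠ j → W i ⊓ W j ≤ N) (hm : ∀ i, Nat.card (W i) = m)
    (hv : ∀ i, Nat.card (W i ⊓ N : Subgroup G) = v) :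
    Nat.card G + Nat.card ι * v = Nat.card N + Nat.card ι * m := by
  classical
  have hbij : Function.Bijective
      (fun y : (Σ i, {x : G // x ∈ W i ∧ x ∉ N}) => (⟨y.2.1, y.2.2.2⟩ : {x : G // x ∉ N})) := by
    constructor
    · rintro ⟨i, x, hx, hxN⟩ ⟨j, y, hy, hyN⟩ h
      obtain rfl : x = y := congrArg Subtype.val h
      obtain rfl : i = j := by
        by_contra hij
        exact hxN (hdisj i j hij ⟨hx, hy⟩)
      rfl
    · rintro ⟨x, hx⟩
      obtain ⟨i, hi⟩ := hcov x hx
      exact ⟨⟨i, x, hi, hx⟩, rfl⟩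
  have h1 := Nat.card_congr (Equiv.ofBijective _ hbij)
  have h2 : ∀ i, Nat.card {x : G // x ∈ W i ∧ x ∉ N} + v = m := by
    intro i
    rw [← hm i, ← hv i]
    have e := Set.ncard_sdiff_add_ncard_of_subset (s := ((W i ⊓ N : Subgroup G) : Set G))
      (t := (W i : Set G)) inf_le_left
    have e2 : (W i : Set G) \ ((W i ⊓ N : Subgroup G) : Set G) = {x | x ∈ W i ∧ x ∉ N} := by
      ext x; simp
    rw [e2] at e
    exact e
  have h3 : Nat.card {x : G // x ∉ N} + Nat.card N = Nat.card G := by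
    have e := Set.ncard_sdiff_add_ncard_of_subset (s := (N : Set G)) (t := Set.univ)
      (Set.subset_univ _)
    rw [Set.ncard_univ, ← Set.compl_eq_univ_sdiff] at e
    exact e
  have hι := Fintype.ofFinite ι
  rw [Nat.card_sigma] at h1
  have h4 : (∑ i, Nat.card {x : G // x ∈ W i ∧ x ∉ N}) + Nat.card ι * v = Nat.card ι * m := by
    have := Finset.sum_congr (rfl : (Finset.univ : Finset ι) = Finset.univ) (fun i _ => h2 i)
    rw [Finset.sum_add_distrib] at this
    simpa using this
  omega

/-! ### Recognising dihedral and quaternion groups -/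

theorem exists_zmod_exp {G : Type*} [Group G] {n : ℕ} {a : G} (ha : orderOf a = n) :
    ∃ E : ZMod n → G, (∀ i j, E (i + j) = E i * E j) ∧ (∀ k : ℤ, E k = a ^ k) ∧
      Function.Injective E := by
  have h0 : (zmultiplesHom (Additive G) (Additive.ofMul a)) n = 0 := by
    rw [zmultiplesHom_apply, natCast_zsmul, ← ofMul_pow, ← ha, pow_orderOf_eq_one, ofMul_one]
  have hk : ∀ k : ℤ, (ZMod.lift n ⟨zmultiplesHom (Additive G) (Additive.ofMul a), h0⟩ k).toMul =
      a ^ k := by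
    intro k
    rw [ZMod.lift_coe]
    rfl
  refine ⟨fun i => (ZMod.lift n ⟨zmultiplesHom (Additive G) (Additive.ofMul a), h0⟩ i).toMul,
    fun i j => by simp only [map_add, toMul_add], hk, ?_⟩
  intro i j h
  obtain ⟨k, rfl⟩ := ZMod.intCast_surjective i
  obtain ⟨l, rfl⟩ := ZMod.intCast_surjective j
  simp only [hk] at h
  rw [ZMod.intCast_eq_intCast_iff, ← ha]
  exact zpow_eq_zpow_iff_modEq.1 h

theorem exists_zmod_exp_conj {G : Type*} [Group G] {n : ℕ} {a x : G} (ha : orderOf a = n)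
    (hxa : x * a * x⁻¹ = a⁻¹) :
    ∃ E : ZMod n → G, (∀ i j, E (i + j) = E i * E j) ∧ (∀ k : ℤ, E k = a ^ k) ∧
      Function.Injective E ∧ (∀ i, E i * x = x * E (-i)) ∧ (∀ i, E i ∈ Subgroup.zpowers a) := by
  obtain ⟨E, hadd, hk, hinj⟩ := exists_zmod_exp ha
  refine ⟨E, hadd, hk, hinj, fun i => ?_, fun i => ?_⟩
  · obtain ⟨k, rfl⟩ := ZMod.intCast_surjective i
    rw [← Int.cast_neg, hk, hk]
    symm
    rw [← mul_inv_eq_iff_eq_mul, ← conj_zpow, hxa, inv_zpow, zpow_neg, inv_inv]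
  · obtain ⟨k, rfl⟩ := ZMod.intCast_surjective i
    rw [hk]
    exact Subgroup.zpow_mem_zpowers a k

theorem nonempty_mulEquiv_dihedralGroup {G : Type*} [Group G] {n : ℕ} [NeZero n] {a x : G}
    (ha : orderOf a = n) (hx : x ∉ Subgroup.zpowers a) (hx2 : x * x = 1)
    (hxa : x * a * x⁻¹ = a⁻¹) (hcard : Nat.card G = 2 * n) : Nonempty (G ≃* DihedralGroup n) := by
  obtain ⟨E, hadd, hk, hinj, hcomm, hmem⟩ := exists_zmod_exp_conj ha hxa
  let f : DihedralGroup n → G := fun y => match y with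
    | .r i => E i
    | .sr i => x * E i
  have hf : ∀ y z, f (y * z) = f y * f z := by
    rintro (i | i) (j | j)
    · exact hadd i j
    · change x * E (j - i) = E i * (x * E j)
      rw [← mul_assoc, hcomm, mul_assoc, ← hadd, neg_add_eq_sub]
    · change x * E (i + j) = x * E i * E j
      rw [hadd, mul_assoc]
    · change E (j - i) = x * E i * (x * E j)
      rw [mul_assoc, ← mul_assoc (E i), hcomm, ← mul_assoc, ← mul_assoc, hx2, one_mul, ← hadd,
        neg_add_eq_sub]
  have hfinj : Function.Injective f := by
    rintro (i | i) (j | j) h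
    · exact congrArg _ (hinj h)
    · exact absurd ((Subgroup.mul_mem_cancel_right _ (hmem j)).1
        ((show E i = x * E j from h) ▸ hmem i)) hx
    · exact absurd ((Subgroup.mul_mem_cancel_right _ (hmem i)).1
        ((show x * E i = E j from h) ▸ hmem j)) hx
    · exact congrArg _ (hinj (mul_left_cancel h))
  have : Finite G := Nat.finite_of_card_ne_zero (by have := NeZero.ne n; omega)
  have hb : Function.Bijective f := by
    rw [Nat.bijective_iff_injective_and_card]
    exact ⟨hfinj, by rw [DihedralGroup.nat_card, hcard]⟩
  exact ⟨(MulEquiv.mk (Equiv.ofBijective f hb) hf).symm⟩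

theorem nonempty_mulEquiv_quaternionGroup {G : Type*} [Group G] {n : ℕ} [NeZero n] {a x : G}
    (ha : orderOf a = 2 * n) (hx : x ∉ Subgroup.zpowers a) (hx2 : x * x = a ^ n)
    (hxa : x * a * x⁻¹ = a⁻¹) (hcard : Nat.card G = 4 * n) :
    Nonempty (G ≃* QuaternionGroup n) := by
  obtain ⟨E, hadd, hk, hinj, hcomm, hmem⟩ := exists_zmod_exp_conj ha hxa
  have hx2' : x * x = E n := by
    have := hk n
    rw [zpow_natCast, Int.cast_natCast] at this
    rw [hx2, this]
  let f : QuaternionGroup n → G := fun y => match y with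
    | .a i => E i
    | .xa i => x * E i
  have hf : ∀ y z, f (y * z) = f y * f z := by
    rintro (i | i) (j | j)
    · exact hadd i j
    · change x * E (j - i) = E i * (x * E j)
      rw [← mul_assoc, hcomm, mul_assoc, ← hadd, neg_add_eq_sub]
    · change x * E (i + j) = x * E i * E j
      rw [hadd, mul_assoc]
    · change E (n + j - i) = x * E i * (x * E j)
      rw [mul_assoc, ← mul_assoc (E i), hcomm, ← mul_assoc, ← mul_assoc, hx2', ← hadd, ← hadd]
      congr 1
      ring
  have hfinj : Function.Injective f := by
    rintro (i | i) (j | j) h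
    · exact congrArg _ (hinj h)
    · exact absurd ((Subgroup.mul_mem_cancel_right _ (hmem j)).1
        ((show E i = x * E j from h) ▸ hmem i)) hx
    · exact absurd ((Subgroup.mul_mem_cancel_right _ (hmem i)).1
        ((show x * E i = E j from h) ▸ hmem j)) hx
    · exact congrArg _ (hinj (mul_left_cancel h))
  have : Finite G := Nat.finite_of_card_ne_zero (by have := NeZero.ne n; omega)
  have hb : Function.Bijective f := by
    rw [Nat.bijective_iff_injective_and_card]
    exact ⟨hfinj, by rw [Nat.card_eq_fintype_card, QuaternionGroup.card, hcard]⟩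
  exact ⟨(MulEquiv.mk (Equiv.ofBijective f hb) hf).symm⟩

/-! ### Geometric sums and the inverting action -/

theorem mul_pow_of_mul_eq_pow_mul {G : Type*} [Group G] {a x : G} {i : ℕ}
    (h : x * a = a ^ i * x) (n : ℕ) :
    (a * x) ^ n = a ^ (∑ k ∈ Finset.range n, i ^ k) * x ^ n := by
  have hm : ∀ m : ℕ, x * a ^ m = a ^ (i * m) * x := by
    intro m
    induction m with
    | zero => simp
    | succ m ih => rw [pow_succ, ← mul_assoc, ih, mul_assoc, h, ← mul_assoc, ← pow_add, mul_add_one]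
  induction n with
  | zero => simp
  | succ n ih =>
    rw [pow_succ', ih, mul_assoc, ← mul_assoc x, hm, geom_sum_succ, pow_succ',
      pow_succ' x, mul_assoc, mul_assoc]

/-- For odd q, reduce modulo p: the sum is 1 if i ≡ 0 or i ≡ -1. The only other case is p = 3 and i
≡ 1, where the sum is q, so q = 3; but 1 + i + i² never vanishes modulo 9. -/
theorem eq_two_of_sq_dvd_geom_sum {p q i : ℕ} (hp : p = 2 ∨ p = 3) (hq : q.Prime)
    (h : p ^ 2 ∣ ∑ k ∈ Finset.range q, i ^ k) : q = 2 := by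
  by_contra hq2
  have hodd : Odd q := hq.odd_of_ne_two hq2
  obtain ⟨m, rfl⟩ := hodd
  rcases hp with rfl | rfl
  · have h1 : ((∑ k ∈ Finset.range (2 * m + 1), i ^ k : ℕ) : ZMod 2) = 0 :=
      (ZMod.natCast_eq_zero_iff _ _).2 ((by norm_num : 2 ∣ 2 ^ 2).trans h)
    push_cast at h1
    rw [geom_sum_succ] at h1
    have h2 : (i : ZMod 2) = 0 ∨ (i : ZMod 2) = -1 := by
      generalize (i : ZMod 2) = j
      revert j; decide
    rcases h2 with h2 | h2 <;> rw [h2] at h1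
    · simp at h1
    · rw [← geom_sum_succ, neg_one_geom_sum] at h1
      simp at h1
  · have h1 : ((∑ k ∈ Finset.range (2 * m + 1), i ^ k : ℕ) : ZMod 3) = 0 :=
      (ZMod.natCast_eq_zero_iff _ _).2 ((by norm_num : 3 ∣ 3 ^ 2).trans h)
    push_cast at h1
    have h3 : (i : ZMod 3) = 0 ∨ (i : ZMod 3) = 1 ∨ (i : ZMod 3) = -1 := by
      generalize (i : ZMod 3) = j
      revert j; decide
    rcases h3 with h3 | h3 | h3 <;> rw [h3] at h1
    · simp [geom_sum_succ] at h1
    · simp only [one_pow, Finset.sum_const, Finset.card_range, nsmul_eq_mul, mul_one] at h1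
      have h4 : 2 * m + 1 = 3 :=
        ((Nat.prime_dvd_prime_iff_eq Nat.prime_three hq).1 ((ZMod.natCast_eq_zero_iff _ _).1 h1)).symm
      rw [h4] at h
      have h5 : ((∑ k ∈ Finset.range 3, i ^ k : ℕ) : ZMod 9) = 0 :=
        (ZMod.natCast_eq_zero_iff _ _).2 h
      push_cast at h5
      generalize (i : ZMod 9) = j at h5
      revert h5
      simp only [Finset.sum_range_succ, Finset.sum_range_zero]
      revert j
      decide
    · rw [neg_one_geom_sum] at h1
      simp at h1

/-- If conjugation by x sends a to a ^ i, then (ax) ^ q is a ^ (1 + i + ⋯ + i ^ (q - 1)) times x ^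
q. Hence p² divides the geometric sum, so q = 2 and p² divides 1 + i. -/
theorem conj_eq_inv_of_pow_eq_one {G : Type*} [Group G] {p q : ℕ} {a x : G} (hp : p = 2 ∨ p = 3)
    (hq : q.Prime) (ha : orderOf a = p ^ 2) (hx : x ^ q = 1) (hax : (a * x) ^ q = 1)
    (hconj : x * a * x⁻¹ ∈ Subgroup.zpowers a) : q = 2 ∧ x * a * x⁻¹ = a⁻¹ := by
  have hfin : IsOfFinOrder a := orderOf_pos_iff.1 (by rcases hp with rfl | rfl <;> simp [ha])
  obtain ⟨i, hi : a ^ i = x * a * x⁻¹⟩ := (IsOfFinOrder.mem_powers_iff_mem_zpowers hfin).2 hconj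
  have h1 : x * a = a ^ i * x := by rw [hi]; group
  rw [mul_pow_of_mul_eq_pow_mul h1, hx, mul_one, ← orderOf_dvd_iff_pow_eq_one, ha] at hax
  obtain rfl := eq_two_of_sq_dvd_geom_sum hp hq hax
  refine ⟨rfl, ?_⟩
  rw [← hi, eq_inv_iff_mul_eq_one, ← pow_succ, ← orderOf_dvd_iff_pow_eq_one, ha]
  simpa [Finset.sum_range_succ, add_comm] using hax

/-- The involution acts by c ↦ c ^ i with i² ≡ 1 and i ≢ 1 modulo 9, which leaves only i = 8, that
is, inversion. -/
theorem nonempty_semidirectProduct_mulEquiv_dihedralGroup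
    (φ : Multiplicative (ZMod 2) →* MulAut (Multiplicative (ZMod 9))) (hφ : φ ≠ 1) :
    Nonempty (Multiplicative (ZMod 9) ⋊[φ] Multiplicative (ZMod 2) ≃* DihedralGroup 9) := by
  set t : Multiplicative (ZMod 2) := Multiplicative.ofAdd 1 with ht
  set c : Multiplicative (ZMod 9) := Multiplicative.ofAdd 1 with hc
  have hcgen : ∀ y : Multiplicative (ZMod 9), ∃ i : ℕ, i < 9 ∧ y = c ^ i := by
    rw [hc]; decide
  obtain ⟨i, hi9, hi⟩ := hcgen (φ t c)
  have htt : ∀ s : Multiplicative (ZMod 2), s = 1 ∨ s = t := by rw [ht]; decide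
  have hne : φ t c ≠ c := by
    intro h
    apply hφ
    refine MonoidHom.ext fun s => MulEquiv.ext fun y => ?_
    obtain ⟨k, -, rfl⟩ := hcgen y
    rcases htt s with rfl | rfl
    · simp
    · simp [h]
  have hsq : φ t (φ t c) = c := by
    rw [← MulAut.mul_apply, ← map_mul, show t * t = 1 by rw [ht]; decide]
    simp
  rw [hi, map_pow, hi, ← pow_mul] at hsq
  rw [hi] at hne
  have hinv : φ t c = c⁻¹ := by
    rw [hi]
    clear hi htt hcgen
    rw [hc] at *
    interval_cases i <;> revert hsq hne <;> decide
  refine nonempty_mulEquiv_dihedralGroup (a := SemidirectProduct.inl c)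
    (x := SemidirectProduct.inr t) ?_ ?_ ?_ ?_ ?_
  · rw [orderOf_injective _ SemidirectProduct.inl_injective, hc, orderOf_ofAdd_eq_addOrderOf]
    simp
  · intro h
    obtain ⟨k, hk⟩ := Subgroup.mem_zpowers_iff.1 h
    have := congrArg SemidirectProduct.rightHom hk
    rw [map_zpow, SemidirectProduct.rightHom_inl, SemidirectProduct.rightHom_inr, one_zpow, ht]
      at this
    revert this
    decide
  · rw [← map_mul, show t * t = 1 by rw [ht]; decide, map_one]
  · rw [← map_inv (SemidirectProduct.inr), ← SemidirectProduct.inl_aut, hinv, map_inv]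
  · rw [SemidirectProduct.card]
    simp

/-! ### The tree order and its rigidity -/

/-- Nodes of a tree whose root is adjacent to one leaf and to the nodes `mid i`, each of which
carries some further leaves `tip k`. -/
inductive TreeNode (ι κ : Type*)
  | root : TreeNode ι κ
  | leaf : TreeNode ι κ
  | mid (i : ι) : TreeNode ι κ
  | tip (k : κ) : TreeNode ι κ

namespace TreeNode

variable {ι κ : Type*}

instance [Finite ι] [Finite κ] : Finite (TreeNode ι κ) := by
  refine Finite.of_surjective (α := (Unit ⊕ Unit) ⊕ (ι ⊕ κ)) (fun
    | .inl (.inl _) => root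
    | .inl (.inr _) => leaf
    | .inr (.inl i) => mid i
    | .inr (.inr k) => tip k) ?_
  rintro (_ | _ | i | k)
  exacts [⟨.inl (.inl ()), rfl⟩, ⟨.inl (.inr ()), rfl⟩, ⟨.inr (.inl i), rfl⟩, ⟨.inr (.inr k), rfl⟩]

/-- The height-two order on the tree for which the root is minimal; `tip k` is attached to
`mid (π k)`. -/
def Below (π : κ → ι) : TreeNode ι κ → TreeNode ι κ → Prop
  | root, leaf => True
  | root, mid _ => True
  | tip k, mid i => π k = i
  | _, _ => False

variable {π : κ → ι}

/-- Two consecutive edges cannot form a chain, since transitivity would make their far ends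
adjacent. So orientations alternate along every path, and the single edge from `root` to `leaf`
fixes them all. -/
theorem iff_below_of_root_leaf {L : TreeNode ι κ → TreeNode ι κ → Prop}
    (htrans : ∀ s t u, L s t → L t u → L s u) (hirr : ∀ s, ¬ L s s)
    (hcomp : ∀ s t, (L s t ∨ L t s) ↔ (Below π s t ∨ Below π t s)) (h : L root leaf)
    (s t : TreeNode ι κ) : L s t ↔ Below π s t := by
  have hmid : ∀ i, L root (mid i) := fun i =>
    ((hcomp root (mid i)).2 (Or.inl trivial)).resolve_right fun h1 =>
      ((hcomp (mid i) leaf).1 (Or.inl (htrans _ _ _ h1 h))).elim id id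
  have htip : ∀ k, L (tip k) (mid (π k)) := fun k =>
    ((hcomp (tip k) (mid (π k))).2 (Or.inl rfl)).resolve_right fun h1 =>
      ((hcomp root (tip k)).1 (Or.inl (htrans _ _ _ (hmid _) h1))).elim id id
  have key : ∀ s t, Below π s t → L s t := by
    rintro (_ | _ | i | k) (_ | _ | j | l) hst <;> try exact hst.elim
    · exact h
    · exact hmid j
    · obtain rfl : π k = j := hst
      exact htip k
  exact ⟨fun hst => ((hcomp s t).1 (Or.inl hst)).resolve_right fun h1 =>
    hirr _ (htrans _ _ _ hst (key _ _ h1)), key s t⟩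

/-- The minimal nodes are `root` and the tips, and only `root` has two nodes above it, so it is
fixed. Among the nodes above `root`, only `leaf` has no tip below it. -/
theorem fixed_of_below_iff (hπ : Function.Surjective π) [Nonempty ι]
    {σ : TreeNode ι κ → TreeNode ι κ} (hσ : Function.Bijective σ)
    (h : ∀ s t, Below π (σ s) (σ t) ↔ Below π s t) : σ root = root ∧ σ leaf = leaf := by
  obtain ⟨i⟩ := ‹Nonempty ι›
  have h1 : Below π (σ root) (σ leaf) := (h _ _).2 trivial
  have h2 : Below π (σ root) (σ (mid i)) := (h _ _).2 trivial
  have h3 : σ leaf ≠ σ (mid i) := fun h3 => by cases hσ.1 h3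
  have hroot : σ root = root := by
    generalize σ root = r, σ leaf = l, σ (mid i) = m at *
    rcases r with _ | _ | _ | k
    · rfl
    · exact h1.elim
    · exact h1.elim
    · rcases l with _ | _ | l | _ <;> try exact h1.elim
      rcases m with _ | _ | m | _ <;> try exact h2.elim
      exact absurd (congrArg mid ((show π k = l from h1).symm.trans h2)) h3
  refine ⟨hroot, ?_⟩
  rw [hroot] at h1
  rcases hl : σ leaf with _ | _ | j | k <;> rw [hl] at h1
  · exact h1.elim
  · obtain ⟨k, rfl⟩ := hπ j
    obtain ⟨s, hs⟩ := hσ.2 (tip k)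
    have h4 : Below π s leaf := by
      rw [← h, hs, hl]
      rfl
    rcases s with _ | _ | _ | _ <;> try exact h4.elim
    rw [hroot] at hs
    cases hs
  · exact h1.elim

end TreeNode

/-! ### Groups whose diagram is the tree -/

theorem IsSubgroupDiagram.exists_map_eq {G T : Type*} [Group G] {r : T → T → Prop}
    {S : T → Subgroup G} (h : IsSubgroupDiagram r S) (φ : G ≃* G) :
    ∃ σ : T → T, Function.Bijective σ ∧ (∀ t, S (σ t) = (S t).map φ.toMonoidHom) ∧
      ∀ s t, S (σ s) < S (σ t) ↔ S s < S t := by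
  have h1 : ∀ (ψ : G ≃* G) t, ∃ t', S t' = ψ.mapSubgroup (S t) := fun ψ t =>
    (h.range_iff _).1 (((h.map_mulEquiv ψ).range_iff _).2 ⟨t, rfl⟩)
  choose σ hσ using h1
  refine ⟨σ φ, ⟨fun s t hst => h.injective (φ.mapSubgroup.injective ?_), fun t => ?_⟩, hσ φ,
    fun s t => by rw [hσ, hσ, OrderIso.lt_iff_lt]⟩
  · rw [← hσ, ← hσ, hst]
  · refine ⟨σ φ.symm t, h.injective ?_⟩
    rw [hσ, hσ]
    exact φ.mapSubgroup.apply_symm_apply (S t)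

theorem IsSubgroupDiagram.eq_bot_or_eq_top_or {G T : Type*} [Group G] {r : T → T → Prop}
    {S : T → Subgroup G} (h : IsSubgroupDiagram r S) (H : Subgroup G) :
    H = ⊥ ∨ H = ⊤ ∨ ∃ t, S t = H := by
  rw [← h.range_iff]
  tauto

theorem IsSubgroupDiagram.le_iff {G T : Type*} [Group G] {r R : T → T → Prop}
    {S : T → Subgroup G} (h : IsSubgroupDiagram r S) (hlt : ∀ s t, S s < S t ↔ R s t) (s t : T) :
    S s ≤ S t ↔ s = t ∨ R s t := by
  rw [le_iff_eq_or_lt, hlt, h.injective.eq_iff]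

open TreeNode

/-- Group automorphisms permute the nodes compatibly with the order, in either orientation, so
rigidity of the tree applies. What is used later is that this subgroup is normal. -/
theorem IsSubgroupDiagram.characteristic_leaf {G ι κ : Type*} [Group G] [Nonempty ι] {π : κ → ι}
    (hπ : Function.Surjective π) {r : TreeNode ι κ → TreeNode ι κ → Prop}
    {S : TreeNode ι κ → Subgroup G} (h : IsSubgroupDiagram r S)
    (hlt : (∀ s t, S s < S t ↔ Below π s t) ∨ (∀ s t, S s < S t ↔ Below π t s)) :
    (S leaf).Characteristic := by
  rw [Subgroup.characteristic_iff_map_eq]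
  intro φ
  obtain ⟨σ, hσ, hmap, hσlt⟩ := h.exists_map_eq φ
  rw [← hmap]
  congr 1
  refine (fixed_of_below_iff hπ hσ fun s t => ?_).2
  rcases hlt with hlt | hlt
  · rw [← hlt, ← hlt, hσlt]
  · rw [← hlt, ← hlt, hσlt]

theorem IsSubgroupDiagram.dihedral_of_below {G ι κ : Type*} [Group G] [Finite G] [Finite κ]
    {π : κ → ι} (hπ : Function.Surjective π) (hπ' : ∀ k, ∃ l, l ≠ k ∧ π l = π k) {p : ℕ}
    (hp : p = 2 ∨ p = 3) (hκ : Nat.card κ = p ^ 2) {r : TreeNode ι κ → TreeNode ι κ → Prop}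
    {S : TreeNode ι κ → Subgroup G} (h : IsSubgroupDiagram r S)
    (hlt : ∀ s t, S s < S t ↔ Below π s t) : Nonempty (G ≃* DihedralGroup (p ^ 2)) := by
  have hpp : p.Prime := by rcases hp with rfl | rfl <;> norm_num
  have hκ0 : Nat.card κ ≠ 0 := by rw [hκ]; exact pow_ne_zero _ hpp.ne_zero
  obtain ⟨k₀⟩ : Nonempty κ := (Nat.card_ne_zero.1 hκ0).1
  have : Nonempty ι := ⟨π k₀⟩
  have hle := h.le_iff hlt
  have hne : ∀ t, S t ≠ ⊥ ∧ S t ≠ ⊤ := fun t => (h.range_iff _).2 ⟨t, rfl⟩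
  have hchar := h.characteristic_leaf hπ (Or.inl hlt)
  have hbelow_tip : ∀ t k, S t ≤ S (tip k) → t = tip k := by
    intro t k ht
    rcases (hle _ _).1 ht with rfl | ht
    · rfl
    · rcases t with _ | _ | _ | _ <;> exact ht.elim
  have htip_leaf : ∀ k, ¬ S (tip k) ≤ S leaf := by
    intro k hk
    rcases (hle _ _).1 hk with hk | hk
    · cases hk
    · exact hk
  have hinf : ∀ H k, ¬ S (tip k) ≤ H → H ⊓ S (tip k) = ⊥ := by
    intro H k hH
    rcases h.eq_bot_or_eq_top_or (H ⊓ S (tip k)) with h1 | h1 | ⟨t, ht⟩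
    · exact h1
    · exact absurd (eq_top_iff.2 (h1.ge.trans inf_le_right)) (hne _).2
    · have h2 := hbelow_tip t k (ht.le.trans inf_le_right)
      rw [h2] at ht
      exact absurd (ht.le.trans inf_le_left) hH
  have hsup : ∀ k, S leaf ⊔ S (tip k) = ⊤ := by
    intro k
    rcases h.eq_bot_or_eq_top_or (S leaf ⊔ S (tip k)) with h1 | h1 | ⟨t, ht⟩
    · exact absurd (eq_bot_iff.2 (le_sup_left.trans h1.le)) (hne leaf).1
    · exact h1
    · rcases (hle leaf t).1 (le_sup_left.trans ht.ge) with rfl | h2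
      · exact absurd (le_sup_right.trans ht.ge) (htip_leaf k)
      · rcases t with _ | _ | _ | _ <;> exact h2.elim
  have hcard : ∀ k, Nat.card G = Nat.card (S leaf) * Nat.card (S (tip k)) := by
    intro k
    rw [← Subgroup.card_sup_of_inf_eq_bot _ _ (hinf _ k (htip_leaf k)), hsup, Subgroup.card_top]
  set q := Nat.card (S (tip k₀)) with hq
  have hA : 0 < Nat.card (S leaf) := Nat.card_pos
  have hcardq : ∀ k, Nat.card (S (tip k)) = q := fun k =>
    Nat.eq_of_mul_eq_mul_left hA ((hcard k).symm.trans (hcard k₀))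
  have hqp : q.Prime := by
    refine Subgroup.card_prime_of_forall_lt_eq_bot (hne _).1 fun K hK => ?_
    rw [← hinf K k₀ hK.not_ge, inf_eq_left.2 hK.le]
  -- Tips have equal orders, so no cyclic subgroup contains two of them. This excludes `⊤` and every
  -- `mid i` as the subgroup generated by an element, the fibres of `π` having at least two points.
  have hncyc : ∀ x k l, l ≠ k → S (tip k) ≤ Subgroup.zpowers x →
      ¬ S (tip l) ≤ Subgroup.zpowers x := by
    intro x k l hkl hk hl
    have h1 := h.injective (Subgroup.eq_of_card_eq_of_le_zpowers hl hk
      ((hcardq l).trans (hcardq k).symm))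
    injection h1 with h1
    exact hkl h1
  have hcov : ∀ x, x ∉ S leaf → ∃ k, x ∈ S (tip k) := by
    intro x hx
    have hxx := Subgroup.mem_zpowers x
    rcases h.eq_bot_or_eq_top_or (Subgroup.zpowers x) with h1 | h1 | ⟨t, ht⟩
    · exact absurd ((Subgroup.zpowers_eq_bot.1 h1) ▸ one_mem _) hx
    · obtain ⟨l, hl, -⟩ := hπ' k₀
      exact absurd (h1 ▸ le_top) (hncyc x k₀ l hl (h1 ▸ le_top))
    · rw [← ht] at hxx
      rcases t with _ | _ | i | k
      · exact absurd ((hle root leaf).2 (Or.inr trivial) hxx) hx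
      · exact absurd hxx hx
      · obtain ⟨k, rfl⟩ := hπ i
        obtain ⟨l, hl, hlk⟩ := hπ' k
        exact absurd (ht ▸ (hle (tip l) (mid (π k))).2 (Or.inr hlk))
          (hncyc x k l hl (ht ▸ (hle (tip k) (mid (π k))).2 (Or.inr rfl)))
      · exact ⟨k, hxx⟩
  have hcount := Subgroup.card_add_mul_card_eq (S leaf) (fun k => S (tip k)) (m := q) (v := 1) hcov
    (fun k l hkl => by
      rw [hinf]
      · exact bot_le
      · intro h1
        have h2 := hbelow_tip _ _ h1
        injection h2 with h2
        exact hkl h2.symm) hcardq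
    (fun k => by rw [inf_comm, hinf _ k (htip_leaf k), Subgroup.card_bot])
  rw [hcard k₀, hκ, ← hq] at hcount
  have hcardA : Nat.card (S leaf) = p ^ 2 := by
    -- The count reads (|A| - p²)(q - 1) = 0; writing q = m + 2 allows cancelling q - 1 = m + 1 in
    -- `ℕ`.
    obtain ⟨m, hm⟩ := Nat.exists_eq_add_of_lt hqp.one_lt
    have hm' : q = m + 2 := by omega
    rw [hm'] at hcount
    have h2 : Nat.card (S leaf) * (m + 1) = p ^ 2 * (m + 1) := by linarith
    exact Nat.eq_of_mul_eq_mul_right (Nat.succ_pos m) h2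
  -- Since `S root` is the only proper nontrivial subgroup of A, any element of A outside it
  -- generates A.
  obtain ⟨a, ha, ha'⟩ := SetLike.exists_of_lt ((hlt root leaf).2 trivial)
  have haz : Subgroup.zpowers a = S leaf := by
    have hle_a : Subgroup.zpowers a ≤ S leaf := by simpa using ha
    rcases h.eq_bot_or_eq_top_or (Subgroup.zpowers a) with h1 | h1 | ⟨t, ht⟩
    · exact absurd ((Subgroup.zpowers_eq_bot.1 h1) ▸ one_mem _) ha'
    · exact absurd (eq_top_iff.2 (h1.ge.trans hle_a)) (hne leaf).2
    · rcases (hle t leaf).1 (ht.le.trans hle_a) with rfl | h2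
      · exact ht.symm
      · rcases t with _ | _ | _ | _ <;> try exact h2.elim
        exact absurd (ht ▸ Subgroup.mem_zpowers a) ha'
  have hord : orderOf a = p ^ 2 := by rw [← Nat.card_zpowers, haz, hcardA]
  obtain ⟨x, hx⟩ : ∃ x, x ∉ S leaf := by
    by_contra! hall
    exact (hne leaf).2 ((Subgroup.eq_top_iff' _).2 hall)
  have hpow : ∀ y, y ∉ S leaf → y ^ q = 1 := by
    intro y hy
    obtain ⟨k, hk⟩ := hcov y hy
    rw [← hcardq k]
    exact congrArg Subtype.val (pow_card_eq_one' (x := (⟨y, hk⟩ : S (tip k))))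
  have hax : a * x ∉ S leaf := by rwa [Subgroup.mul_mem_cancel_left _ ha]
  have hconj : x * a * x⁻¹ ∈ Subgroup.zpowers a := by
    rw [haz]
    exact Subgroup.Normal.conj_mem inferInstance a ha x
  obtain ⟨hq2, hinv⟩ := conj_eq_inv_of_pow_eq_one hp hqp hord (hpow x hx) (hpow _ hax) hconj
  have : NeZero (p ^ 2) := ⟨pow_ne_zero _ hpp.ne_zero⟩
  refine nonempty_mulEquiv_dihedralGroup hord (haz ▸ hx) ?_ hinv ?_
  · rw [← sq, ← hq2]
    exact hpow x hx
  · rw [hcard k₀, hcardA, ← hq, hq2, mul_comm]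

/-- In the dual order A = `S leaf` is minimal, hence of prime order, and normal. It is complemented
in `G` by each tip and in `S root` by each `mid i`. The tips cover the complement of `S root` and
meet `S root` in the `mid` subgroups, so counting gives |A| = κ. -/
theorem IsSubgroupDiagram.not_below_swap {G ι κ : Type*} [Group G] [Finite G] [Finite κ]
    {π : κ → ι} (hπ : Function.Surjective π) (hπ' : ∀ k, ∃ l, l ≠ k ∧ π l = π k) [Nonempty κ]
    (hκ : ¬ (Nat.card κ).Prime) {r : TreeNode ι κ → TreeNode ι κ → Prop}
    {S : TreeNode ι κ → Subgroup G} (h : IsSubgroupDiagram r S)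
    (hlt : ∀ s t, S s < S t ↔ Below π t s) : False := by
  obtain ⟨k₀⟩ := ‹Nonempty κ›
  have : Nonempty ι := ⟨π k₀⟩
  have hle := h.le_iff hlt
  have hne : ∀ t, S t ≠ ⊥ ∧ S t ≠ ⊤ := fun t => (h.range_iff _).2 ⟨t, rfl⟩
  have hchar := h.characteristic_leaf hπ (Or.inr hlt)
  have hbelow_leaf : ∀ t, S t ≤ S leaf → t = leaf := by
    intro t ht
    rcases (hle _ _).1 ht with rfl | ht
    · rfl
    · rcases t with _ | _ | _ | _ <;> exact ht.elim
  have hbelow_tip : ∀ t k, S t ≤ S (tip k) → t = tip k ∨ t = mid (π k) := by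
    intro t k ht
    rcases (hle _ _).1 ht with rfl | ht
    · exact Or.inl rfl
    · rcases t with _ | _ | i | _ <;> try exact ht.elim
      exact Or.inr (congrArg mid (show π k = i from ht).symm)
  have hleaf_root : S leaf ≤ S root := (hle _ _).2 (Or.inr trivial)
  have hmid_root : ∀ i, S (mid i) ≤ S root := fun i => (hle _ _).2 (Or.inr trivial)
  have hmid_tip : ∀ k, S (mid (π k)) ≤ S (tip k) := fun k => (hle _ _).2 (Or.inr rfl)
  have hleaf_tip : ∀ k, ¬ S leaf ≤ S (tip k) := fun k hk => by
    rcases hbelow_tip _ _ hk with hk | hk <;> cases hk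
  have htip_root : ∀ k, ¬ S (tip k) ≤ S root := fun k hk => by
    rcases (hle _ _).1 hk with hk | hk
    · cases hk
    · exact hk
  have hinf : ∀ H, ¬ S leaf ≤ H → S leaf ⊓ H = ⊥ := by
    intro H hH
    rcases h.eq_bot_or_eq_top_or (S leaf ⊓ H) with h1 | h1 | ⟨t, ht⟩
    · exact h1
    · exact absurd (eq_top_iff.2 (h1.ge.trans inf_le_left)) (hne _).2
    · have h2 := hbelow_leaf t (ht.le.trans inf_le_left)
      rw [h2] at ht
      exact absurd (ht.le.trans inf_le_right) hH
  have hsup : ∀ t, t ≠ leaf → S leaf ⊔ S t = S root ∨ S leaf ⊔ S t = ⊤ := by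
    intro t hne_t
    rcases h.eq_bot_or_eq_top_or (S leaf ⊔ S t) with h1 | h1 | ⟨u, hu⟩
    · exact absurd (eq_bot_iff.2 (le_sup_left.trans h1.le)) (hne leaf).1
    · exact Or.inr h1
    · rcases (hle leaf u).1 (le_sup_left.trans hu.ge) with rfl | h2
      · exact absurd (hbelow_leaf t (le_sup_right.trans hu.ge)) hne_t
      · rcases u with _ | _ | _ | _ <;> try exact h2.elim
        exact Or.inl hu.symm
  have hcard_tip : ∀ k, Nat.card G = Nat.card (S leaf) * Nat.card (S (tip k)) := by
    intro k
    rw [← Subgroup.card_sup_of_inf_eq_bot _ _ (hinf _ (hleaf_tip k)),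
      (hsup (tip k) (by rintro ⟨⟩)).resolve_left
        fun h1 => htip_root k (le_sup_right.trans h1.le), Subgroup.card_top]
  have hcard_mid : ∀ i, Nat.card (S root) = Nat.card (S leaf) * Nat.card (S (mid i)) := by
    intro i
    obtain ⟨k, rfl⟩ := hπ i
    rw [← Subgroup.card_sup_of_inf_eq_bot _ _ (hinf _ fun h1 =>
      hleaf_tip k (h1.trans (hmid_tip k))), (hsup (mid (π k)) (by rintro ⟨⟩)).resolve_right fun h1 =>
        (hne root).2 (eq_top_iff.2 (h1.ge.trans (sup_le hleaf_root (hmid_root _))))]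
  have hA : 0 < Nat.card (S leaf) := Nat.card_pos
  have hm : ∀ k, Nat.card (S (tip k)) = Nat.card (S (tip k₀)) := fun k =>
    Nat.eq_of_mul_eq_mul_left hA ((hcard_tip k).symm.trans (hcard_tip k₀))
  have hv : ∀ i, Nat.card (S (mid i)) = Nat.card (S (mid (π k₀))) := fun i =>
    Nat.eq_of_mul_eq_mul_left hA ((hcard_mid i).symm.trans (hcard_mid (π k₀)))
  have hprime : (Nat.card (S leaf)).Prime :=
    Subgroup.card_prime_of_forall_lt_eq_bot (hne _).1 fun K hK => by
      rw [← hinf K hK.not_ge, inf_eq_right.2 hK.le]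
  have hcov : ∀ x, x ∉ S root → ∃ k, x ∈ S (tip k) := by
    intro x hx
    have hxx := Subgroup.mem_zpowers x
    rcases h.eq_bot_or_eq_top_or (Subgroup.zpowers x) with h1 | h1 | ⟨t, ht⟩
    · exact absurd ((Subgroup.zpowers_eq_bot.1 h1) ▸ one_mem _) hx
    · obtain ⟨l, hl, -⟩ := hπ' k₀
      have h2 := h.injective (Subgroup.eq_of_card_eq_of_le_zpowers (x := x) (h1 ▸ le_top)
        (h1 ▸ le_top) (hm l))
      injection h2 with h2
      exact absurd h2 hl
    · rw [← ht] at hxx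
      rcases t with _ | _ | i | k
      · exact absurd hxx hx
      · exact absurd (hleaf_root hxx) hx
      · exact absurd (hmid_root i hxx) hx
      · exact ⟨k, hxx⟩
  have htip_inf : ∀ k, S (tip k) ⊓ S root = S (mid (π k)) := by
    intro k
    have hge : S (mid (π k)) ≤ S (tip k) ⊓ S root := le_inf (hmid_tip k) (hmid_root _)
    rcases h.eq_bot_or_eq_top_or (S (tip k) ⊓ S root) with h1 | h1 | ⟨t, ht⟩
    · exact absurd (eq_bot_iff.2 (hge.trans h1.le)) (hne _).1
    · exact absurd (eq_top_iff.2 (h1.ge.trans inf_le_left)) (hne _).2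
    · rcases hbelow_tip t k (ht.le.trans inf_le_left) with rfl | rfl
      · exact absurd (ht.le.trans inf_le_right) (htip_root k)
      · exact ht.symm
  have hcount := Subgroup.card_add_mul_card_eq (S root) (fun k => S (tip k)) hcov
    (fun k l hkl => by
      rcases h.eq_bot_or_eq_top_or (S (tip k) ⊓ S (tip l)) with h1 | h1 | ⟨t, ht⟩
      · exact h1.le.trans bot_le
      · exact absurd (eq_top_iff.2 (h1.ge.trans inf_le_left)) (hne _).2
      · rw [← ht]
        rcases hbelow_tip t k (ht.le.trans inf_le_left) with rfl | rfl
        · rcases hbelow_tip _ l (ht.le.trans inf_le_right) with h2 | h2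
          · injection h2 with h2
            exact absurd h2 hkl
          · cases h2
        · exact hmid_root _) hm
    (fun k => by rw [htip_inf, hv])
  have hGne : Nat.card (S root) ≠ Nat.card G := fun h1 =>
    (hne root).2 (Subgroup.eq_top_of_card_eq _ h1)
  rw [hcard_tip k₀, hcard_mid (π k₀)] at hcount hGne
  have hmv : Nat.card (S (mid (π k₀))) ≠ Nat.card (S (tip k₀)) := fun h1 => hGne (by rw [h1])
  refine hκ ?_
  convert hprime using 1
  -- With m and v the orders of the tips and mids, the count is |A|m + κv = |A|v + κm, which
  -- factors; m ≠ v because `S root` is proper.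
  zify at hcount hmv ⊢
  have h2 : ((Nat.card κ : ℤ) - Nat.card (S leaf)) *
      (Nat.card (S (mid (π k₀))) - Nat.card (S (tip k₀))) = 0 := by linarith
  exact sub_eq_zero.1 ((mul_eq_zero.1 h2).resolve_right (sub_ne_zero.2 hmv))

theorem IsSubgroupDiagram.nonempty_mulEquiv_dihedralGroup {G ι κ : Type*} [Group G] [Finite ι]
    [Finite κ] {π : κ → ι} (hπ : Function.Surjective π) (hπ' : ∀ k, ∃ l, l ≠ k ∧ π l = π k) {p : ℕ}
    (hp : p = 2 ∨ p = 3) (hκ : Nat.card κ = p ^ 2)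
    {S : TreeNode ι κ → Subgroup G} (h : IsSubgroupDiagram (Below π) S) :
    Nonempty (G ≃* DihedralGroup (p ^ 2)) := by
  have := h.finite
  rcases (h.comparable_iff root leaf).2 (Or.inl trivial) with h1 | h1
  · refine h.dihedral_of_below hπ hπ' hp hκ ?_
    exact iff_below_of_root_leaf (L := fun s t => S s < S t) (fun _ _ _ => lt_trans)
      (fun _ => lt_irrefl _) h.comparable_iff h1
  · have hκ0 : Nat.card κ ≠ 0 := by rw [hκ]; rcases hp with rfl | rfl <;> norm_num
    have : Nonempty κ := (Nat.card_ne_zero.1 hκ0).1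
    refine (h.not_below_swap hπ hπ' ?_ fun s t => ?_).elim
    · rw [hκ]
      rcases hp with rfl | rfl <;> norm_num
    · exact iff_below_of_root_leaf (L := fun s t => S t < S s) (fun _ _ _ h1 h2 => h2.trans h1)
        (fun _ => lt_irrefl _) (fun s t => or_comm.trans (h.comparable_iff s t)) h1 t s

theorem isSubgroupDiagram_of_le_iff {G T : Type*} [Group G] {R : T → T → Prop}
    {S : T → Subgroup G} (hle : ∀ s t, S s ≤ S t ↔ s = t ∨ R s t) (hR : ∀ s t, R s t → ¬ R t s)
    (hne : ∀ t, S t ≠ ⊥ ∧ S t ≠ ⊤) (hS : ∀ H, H ≠ ⊥ → H ≠ ⊤ → ∃ t, S t = H) :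
    IsSubgroupDiagram R S := by
  have hlt : ∀ s t, S s < S t ↔ R s t := by
    intro s t
    rw [lt_iff_le_not_ge, hle, hle]
    constructor
    · rintro ⟨rfl | h1, h2⟩
      · exact absurd (Or.inl rfl) h2
      · exact h1
    · refine fun h => ⟨Or.inr h, ?_⟩
      rintro (rfl | h1)
      · exact hR _ _ h h
      · exact hR _ _ h h1
  refine ⟨fun s t hst => ?_, fun H => ⟨fun hH => hS H hH.1 hH.2, ?_⟩, fun s t => by rw [hlt, hlt]⟩
  · rcases (hle s t).1 hst.le with h | h
    · exact h
    · exact absurd ((hlt s t).2 h) (hst ▸ lt_irrefl _)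
  · rintro ⟨t, rfl⟩
    exact hne t

/-! ### Subgroups of the dihedral groups of orders 8 and 18 -/

namespace DihedralGroup

open TreeNode

variable {n m : ℕ} (π : ZMod n →+* ZMod m)

/-- Membership in the subgroup of `DihedralGroup n` attached to a node: `root` is the rotations in
`ker π`, `leaf` all rotations, `mid i` and `tip k` are generated by a reflection over `root` and
over the trivial group. -/
def NodeMem : TreeNode (ZMod m) (ZMod n) → DihedralGroup n → Prop
  | root, r k => π k = 0
  | root, sr _ => False
  | leaf, r _ => True
  | leaf, sr _ => False
  | mid _, r k => π k = 0
  | mid i, sr k => π k = i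
  | tip _, r k => k = 0
  | tip l, sr k => k = l

/-- The subgroup of `DihedralGroup n` attached to a node. -/
def nodeSubgroup (t : TreeNode (ZMod m) (ZMod n)) : Subgroup (DihedralGroup n) where
  carrier := {x | NodeMem π t x}
  one_mem' := by
    rw [one_def]
    rcases t with _ | _ | _ | _
    exacts [map_zero π, trivial, map_zero π, rfl]
  mul_mem' := by
    intro x y
    rcases t with _ | _ | i | l <;> rcases x with j | j <;> rcases y with k | k <;>
      simp +contextual [NodeMem, r_mul_r, r_mul_sr, sr_mul_r, sr_mul_sr, -r_zero]
  inv_mem' := by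
    intro x
    rcases t with _ | _ | i | l <;> rcases x with j | j <;> simp [NodeMem]

variable {π}

/-- `hunit` and `hker` say that the rotations of a subgroup are everything, `ker π`, or trivial. Its
reflections, if any, form one coset of these rotations, and this pair determines the node. -/
theorem isSubgroupDiagram_nodeSubgroup (hπ : Function.Surjective π) (hm : (1 : ZMod m) ≠ 0)
    (hunit : ∀ k l, π k ≠ 0 → ∃ c : ℤ, k * c = l)
    (hker : ∀ k l, k ≠ 0 → π k = 0 → π l = 0 → ∃ c : ℤ, k * c = l)
    (hne : ∃ k, k ≠ 0 ∧ π k = 0) : IsSubgroupDiagram (Below π) (nodeSubgroup π) := by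
  obtain ⟨k₀, hk₀, hπk₀⟩ := hne
  have hmem : ∀ t x, x ∈ nodeSubgroup π t ↔ NodeMem π t x := fun _ _ => Iff.rfl
  refine isSubgroupDiagram_of_le_iff (fun s t => ⟨fun h => ?_, ?_⟩) ?_ (fun t => ⟨?_, ?_⟩) ?_
  · have hr : ∀ k, NodeMem π s (r k) → NodeMem π t (r k) := fun k hk => h hk
    have hsr : ∀ k, NodeMem π s (sr k) → NodeMem π t (sr k) := fun k hk => h hk
    rcases s with _ | _ | i | k <;> rcases t with _ | _ | j | l
    · exact Or.inl rfl
    · exact Or.inr trivial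
    · exact Or.inr trivial
    · exact absurd (hr k₀ hπk₀) hk₀
    · exact absurd ((map_one π).symm.trans (hr 1 trivial)) hm
    · exact Or.inl rfl
    · exact absurd ((map_one π).symm.trans (hr 1 trivial)) hm
    · exact absurd (hr k₀ trivial) hk₀
    · obtain ⟨k, hk⟩ := hπ i
      exact (hsr k hk).elim
    · obtain ⟨k, hk⟩ := hπ i
      exact (hsr k hk).elim
    · obtain ⟨k, hk⟩ := hπ i
      exact Or.inl (congrArg mid (hk.symm.trans (hsr k hk)))
    · exact absurd (hr k₀ hπk₀) hk₀
    · exact (hsr k rfl).elim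
    · exact (hsr k rfl).elim
    · exact Or.inr (hsr k rfl)
    · exact Or.inl (congrArg tip (hsr k rfl))
  · rintro (rfl | h)
    · exact le_rfl
    · rintro (k | k) hk <;> rw [hmem] at hk ⊢ <;> rcases s with _ | _ | i | l <;>
        rcases t with _ | _ | j | l' <;> simp_all [NodeMem, Below]
  · rintro (_ | _ | i | l) (_ | _ | j | l') <;> simp [Below]
  · intro h
    have hbot : ∀ x, NodeMem π t x → x = 1 := fun x hx =>
      Subgroup.mem_bot.1 (h ▸ (show x ∈ nodeSubgroup π t from hx))
    rcases t with _ | _ | i | l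
    · exact hk₀ (r.inj ((hbot (r k₀) hπk₀).trans one_def))
    · exact hk₀ (r.inj ((hbot (r k₀) trivial).trans one_def))
    · exact hk₀ (r.inj ((hbot (r k₀) hπk₀).trans one_def))
    · have := hbot (sr l) rfl
      cases this
  · intro h
    have htop : ∀ x, NodeMem π t x := fun x => by
      rw [← hmem, h]
      exact Subgroup.mem_top x
    rcases t with _ | _ | i | l
    · exact (htop (sr 0)).elim
    · exact (htop (sr 0)).elim
    · exact hm ((map_one π).symm.trans (htop (r 1)))
    · exact hk₀ (htop (r k₀))
  · intro H hbot htop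
    have hz : ∀ k l, r k ∈ H → (∃ c : ℤ, k * c = l) → r l ∈ H := by
      rintro k _ hk ⟨c, rfl⟩
      rw [← r_zpow]
      exact H.zpow_mem hk c
    have hsr : ∀ k l, sr k ∈ H → (sr l ∈ H ↔ r (l - k) ∈ H) := by
      intro k l hk
      rw [← sr_mul_sr, H.mul_mem_cancel_left hk]
    by_cases h1 : ∃ k, r k ∈ H ∧ π k ≠ 0
    · obtain ⟨k, hk, hπk⟩ := h1
      have hall : ∀ l, r l ∈ H := fun l => hz k l hk (hunit k l hπk)
      have hno : ∀ l, sr l ∉ H := by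
        intro l hl
        refine htop ((Subgroup.eq_top_iff' _).2 ?_)
        rintro (j | j)
        · exact hall j
        · exact (hsr l j hl).2 (hall _)
      refine ⟨leaf, SetLike.ext ?_⟩
      rintro (j | j)
      · exact iff_of_true trivial (hall j)
      · exact iff_of_false id (hno j)
    push Not at h1
    by_cases h2 : ∃ k, r k ∈ H ∧ k ≠ 0
    · obtain ⟨k, hk, hk0⟩ := h2
      have hall : ∀ l, r l ∈ H ↔ π l = 0 := fun l =>
        ⟨h1 l, fun hl => hz k l hk (hker k l hk0 (h1 k hk) hl)⟩
      by_cases h3 : ∃ l, sr l ∈ H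
      · obtain ⟨l, hl⟩ := h3
        refine ⟨mid (π l), SetLike.ext ?_⟩
        rintro (j | j)
        · exact (hall j).symm
        · rw [hsr l j hl, hall, map_sub, sub_eq_zero]
          rfl
      · push Not at h3
        refine ⟨root, SetLike.ext ?_⟩
        rintro (j | j)
        · exact (hall j).symm
        · exact iff_of_false id (h3 j)
    push Not at h2
    have hall : ∀ l, r l ∈ H ↔ l = 0 := fun l => ⟨h2 l, fun hl => by
      rw [hl, r_zero]
      exact H.one_mem⟩
    by_cases h3 : ∃ l, sr l ∈ H
    · obtain ⟨l, hl⟩ := h3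
      refine ⟨tip l, SetLike.ext ?_⟩
      rintro (j | j)
      · exact (hall j).symm
      · rw [hsr l j hl, hall, sub_eq_zero]
        rfl
    · push Not at h3
      refine absurd ((Subgroup.eq_bot_iff_forall _).2 ?_) hbot
      rintro (j | j) hj
      · rw [(hall j).1 hj, r_zero]
      · exact absurd hj (h3 j)

theorem exists_int_mul_eq {n : ℕ} {k l : ZMod n} (h : ∃ c : Fin n, k * (c.1 : ZMod n) = l) :
    ∃ c : ℤ, k * c = l := by
  obtain ⟨c, hc⟩ := h
  exact ⟨c.1, by exact_mod_cast hc⟩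

theorem isSubgroupDiagram_four : IsSubgroupDiagram
    (Below (ZMod.castHom (by norm_num : 2 ∣ 4) (ZMod 2)))
    (nodeSubgroup (ZMod.castHom (by norm_num : 2 ∣ 4) (ZMod 2))) := by
  refine isSubgroupDiagram_nodeSubgroup (ZMod.castHom_surjective _) (by decide)
    (fun k l h => exists_int_mul_eq ?_) (fun k l h1 h2 h3 => exists_int_mul_eq ?_) (by decide)
  · revert k l; decide
  · revert k l; decide

theorem isSubgroupDiagram_nine : IsSubgroupDiagram
    (Below (ZMod.castHom (by norm_num : 3 ∣ 9) (ZMod 3)))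
    (nodeSubgroup (ZMod.castHom (by norm_num : 3 ∣ 9) (ZMod 3))) := by
  refine isSubgroupDiagram_nodeSubgroup (ZMod.castHom_surjective _) (by decide)
    (fun k l h => exists_int_mul_eq ?_) (fun k l h1 h2 h3 => exists_int_mul_eq ?_) (by decide)
  · revert k l; decide
  · revert k l; decide

end DihedralGroup

/-! ### The star order and the subgroups of the quaternion group -/

/-- The order on `Option ι` in which `none` is below every `some i`. -/
def StarBelow {ι : Type*} (s t : Option ι) : Prop := s = none ∧ t ≠ none

theorem iff_starBelow_of_none_some {ι : Type*} {L : Option ι → Option ι → Prop}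
    (htrans : ∀ s t u, L s t → L t u → L s u) (hirr : ∀ s, ¬ L s s)
    (hcomp : ∀ s t, (L s t ∨ L t s) ↔ (StarBelow s t ∨ StarBelow t s)) {i : ι}
    (h : L none (some i)) (s t : Option ι) : L s t ↔ StarBelow s t := by
  have hsome : ∀ j, L none (some j) := fun j =>
    ((hcomp none (some j)).2 (Or.inl ⟨rfl, by simp⟩)).resolve_right fun h1 => by
      rcases (hcomp (some j) (some i)).1 (Or.inl (htrans _ _ _ h1 h)) with h2 | h2 <;> cases h2.1
  have key : ∀ s t, StarBelow s t → L s t := by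
    rintro s t ⟨rfl, ht⟩
    obtain ⟨j, rfl⟩ := Option.ne_none_iff_exists'.1 ht
    exact hsome j
  exact ⟨fun hst => ((hcomp s t).1 (Or.inl hst)).resolve_right fun h1 =>
    hirr _ (htrans _ _ _ hst (key _ _ h1)), key s t⟩

namespace QuaternionGroup

/-- Generators of the center of `QuaternionGroup 2` and of its cyclic subgroups of order four. -/
def starGen (t : Option (Fin 3)) : QuaternionGroup 2 :=
  t.elim (a 2) ![a 1, xa 0, xa 1]

/-- The powers of `starGen t`. -/
def StarMem (t : Option (Fin 3)) (x : QuaternionGroup 2) : Prop :=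
  ∃ k : Fin 4, x = starGen t ^ k.1

instance (t : Option (Fin 3)) (x : QuaternionGroup 2) : Decidable (StarMem t x) :=
  inferInstanceAs (Decidable (∃ _, _))

/-- The center of `QuaternionGroup 2` and its three cyclic subgroups of order four. -/
def starSubgroup (t : Option (Fin 3)) : Subgroup (QuaternionGroup 2) where
  carrier := {x | StarMem t x}
  one_mem' := ⟨0, rfl⟩
  mul_mem' := by
    rintro _ _ ⟨k, rfl⟩ ⟨l, rfl⟩
    revert t k l
    unfold StarMem
    simp only [Set.mem_ofPred_eq]
    decide
  inv_mem' := by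
    rintro _ ⟨k, rfl⟩
    revert t k
    unfold StarMem
    simp only [Set.mem_ofPred_eq]
    decide

theorem isSubgroupDiagram_starSubgroup : IsSubgroupDiagram StarBelow starSubgroup := by
  refine isSubgroupDiagram_of_le_iff ?_ ?_ ?_ ?_
  · change ∀ s t, (∀ x, StarMem s x → StarMem t x) ↔ s = t ∨ (s = none ∧ t ≠ none)
    decide
  · rintro s t ⟨rfl, h1⟩ ⟨rfl, -⟩
    exact h1 rfl
  · intro t
    constructor
    · have h1 : ∀ t, ∃ x, StarMem t x ∧ x ≠ 1 := by decide
      obtain ⟨x, hx, hx1⟩ := h1 t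
      intro h
      exact hx1 (Subgroup.mem_bot.1 (h ▸ (show x ∈ starSubgroup t from hx)))
    · have h1 : ∀ t, ∃ x, ¬ StarMem t x := by decide
      obtain ⟨x, hx⟩ := h1 t
      intro h
      exact hx (show x ∈ starSubgroup t from h ▸ Subgroup.mem_top x)
  · intro H hbot htop
    have hmem : ∀ t x, x ∈ starSubgroup t ↔ StarMem t x := fun _ _ => Iff.rfl
    -- The central involution lies in every nontrivial subgroup: each other nontrivial element
    -- squares to it.
    have hz : a 2 ∈ H := by
      obtain ⟨⟨x, hx⟩, hx1⟩ := Subgroup.ne_bot_iff_exists_ne_one.1 hbot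
      have h1 : ∀ x : QuaternionGroup 2, x ≠ 1 → x = a 2 ∨ x * x = a 2 := by decide
      rcases h1 x (fun h => hx1 (Subtype.ext h)) with h2 | h2
      · exact h2 ▸ hx
      · exact h2 ▸ H.mul_mem hx hx
    by_cases h1 : ∀ x ∈ H, StarMem none x
    · refine ⟨none, le_antisymm ?_ h1⟩
      rintro _ ⟨k, rfl⟩
      exact H.pow_mem hz _
    · push Not at h1
      obtain ⟨x, hx, hx1⟩ := h1
      have h2 : ∀ x, ∃ i, StarMem (some i) x := by decide
      obtain ⟨i, hi⟩ := h2 x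
      have h3 : ∀ i x, StarMem (some i) x → ¬ StarMem none x →
          ∀ y, StarMem (some i) y → ∃ k : Fin 4, y = x ^ k.1 := by decide
      have hle : starSubgroup (some i) ≤ H := by
        intro y hy
        obtain ⟨k, rfl⟩ := h3 i x hi hx1 y hy
        exact H.pow_mem hx _
      refine ⟨some i, le_antisymm hle fun y hy => ?_⟩
      by_contra hyi
      refine htop ((Subgroup.eq_top_iff' _).2 fun z => ?_)
      -- The subgroups of order four have index two, so adjoining any outside element y gives
      -- everything.
      have h4 : ∀ i y, ¬ StarMem (some i) y → ∀ z, StarMem (some i) z ∨ StarMem (some i) (z * y) := by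
        decide
      rcases h4 i y hyi z with h5 | h5
      · exact hle h5
      · exact (H.mul_mem_cancel_right hy).1 (hle h5)

end QuaternionGroup

/-! ### Groups whose diagram is the star -/

theorem IsSubgroupDiagram.quaternion_of_starBelow {G : Type*} [Group G] [Finite G]
    {r : Option (Fin 3) → Option (Fin 3) → Prop} {S : Option (Fin 3) → Subgroup G}
    (h : IsSubgroupDiagram r S) (hlt : ∀ s t, S s < S t ↔ StarBelow s t) :
    Nonempty (G ≃* QuaternionGroup 2) := by
  have hle := h.le_iff hlt
  have hne : ∀ t, S t ≠ ⊥ ∧ S t ≠ ⊤ := fun t => (h.range_iff _).2 ⟨t, rfl⟩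
  have hbelow : ∀ t i, S t ≤ S (some i) → t = some i ∨ t = none := fun t i ht =>
    ((hle _ _).1 ht).imp id And.left
  have hroot : ∀ i, S none < S (some i) := fun i => (hlt _ _).2 ⟨rfl, by simp⟩
  set l := Nat.card (S none) with hl
  have hprime : l.Prime :=
    Subgroup.card_prime_of_forall_lt_eq_bot (hne _).1 fun K hK => by
      rcases h.eq_bot_or_eq_top_or K with h1 | h1 | ⟨t, rfl⟩
      · exact h1
      · exact absurd (h1 ▸ hK) not_top_lt
      · exact absurd rfl ((hlt _ _).1 hK).2
  have hgen : ∀ i x, x ∈ S (some i) → x ∉ S none → Subgroup.zpowers x = S (some i) := by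
    intro i x hx hx'
    have hxle : Subgroup.zpowers x ≤ S (some i) := by simpa using hx
    rcases h.eq_bot_or_eq_top_or (Subgroup.zpowers x) with h1 | h1 | ⟨t, ht⟩
    · exact absurd ((Subgroup.zpowers_eq_bot.1 h1) ▸ one_mem _) hx'
    · exact absurd (eq_top_iff.2 (h1.ge.trans hxle)) (hne _).2
    · rcases hbelow t i (ht.le.trans hxle) with rfl | rfl
      · exact ht.symm
      · exact absurd (ht ▸ Subgroup.mem_zpowers x) hx'
  have hcard : ∀ i, Nat.card (S (some i)) = l ^ 2 := by
    intro i
    obtain ⟨x, hx, hx'⟩ := SetLike.exists_of_lt (hroot i)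
    have hxi := hgen i x hx hx'
    have hord : orderOf x = Nat.card (S (some i)) := by rw [← hxi, Nat.card_zpowers]
    obtain ⟨d, hd⟩ : l ∣ Nat.card (S (some i)) := Subgroup.card_dvd_of_le (hroot i).le
    have hd0 : d ≠ 0 := by
      rintro rfl
      exact Nat.card_pos.ne' hd
    -- The order of `S (some i)` is ld, and `x ^ l` generates a subgroup of order d. Being neither
    -- trivial nor the whole of `S (some i)`, it is `S none`, so d = l.
    have hcd : Nat.card (Subgroup.zpowers (x ^ l)) = d := by
      rw [Nat.card_zpowers, orderOf_pow_of_dvd hprime.ne_zero ⟨d, hord.trans hd⟩, hord, hd,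
        Nat.mul_div_cancel_left _ hprime.pos]
    have hxle : Subgroup.zpowers (x ^ l) ≤ S (some i) := by simpa using pow_mem hx l
    rcases h.eq_bot_or_eq_top_or (Subgroup.zpowers (x ^ l)) with h1 | h1 | ⟨t, ht⟩
    · rw [h1, Subgroup.card_bot] at hcd
      rw [← hcd, mul_one] at hd
      exact absurd (Subgroup.eq_of_le_of_card_ge (hroot i).le hd.le) (hroot i).ne
    · exact absurd (eq_top_iff.2 (h1.ge.trans hxle)) (hne _).2
    · rcases hbelow t i (ht.le.trans hxle) with rfl | rfl
      · rw [← ht, hd] at hcd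
        exact absurd (Nat.eq_of_mul_eq_mul_right (Nat.pos_of_ne_zero hd0)
          (hcd.trans (one_mul d).symm)) hprime.ne_one
      · rw [hd, ← hcd, ← ht, sq]
  have hcov : ∀ x, x ∉ S none → ∃ i, Subgroup.zpowers x = S (some i) := by
    intro x hx
    rcases h.eq_bot_or_eq_top_or (Subgroup.zpowers x) with h1 | h1 | ⟨t, ht⟩
    · exact absurd ((Subgroup.zpowers_eq_bot.1 h1) ▸ one_mem _) hx
    · have h2 := h.injective (Subgroup.eq_of_card_eq_of_le_zpowers (x := x) (h1 ▸ le_top)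
        (h1 ▸ le_top) ((hcard 0).trans (hcard 1).symm))
      exact absurd h2 (by decide)
    · rcases t with _ | i
      · exact absurd (ht ▸ Subgroup.mem_zpowers x) hx
      · exact ⟨i, ht.symm⟩
  have hdisj : ∀ i j, i ≠ j → S (some i) ⊓ S (some j) ≤ S none := by
    intro i j hij
    rcases h.eq_bot_or_eq_top_or (S (some i) ⊓ S (some j)) with h1 | h1 | ⟨t, ht⟩
    · exact h1.le.trans bot_le
    · exact absurd (eq_top_iff.2 (h1.ge.trans inf_le_left)) (hne _).2
    · rw [← ht]
      rcases hbelow t i (ht.le.trans inf_le_left) with rfl | rfl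
      · rcases hbelow _ j (ht.le.trans inf_le_right) with h2 | h2
        · exact absurd (Option.some_injective _ h2) hij
        · cases h2
      · exact le_rfl
  have hcount := Subgroup.card_add_mul_card_eq (S none) (fun i => S (some i))
    (fun x hx => (hcov x hx).imp fun i hi => hi.le (Subgroup.mem_zpowers x)) hdisj hcard
    (fun i => by rw [inf_eq_right.2 (hroot i).le])
  rw [Nat.card_fin, ← hl] at hcount
  -- Since l² divides |G|, write |G| = l²c; cancelling l in the count leaves lc + 2 = 3l, so l
  -- divides 2.
  have hl2 : l = 2 := by
    obtain ⟨c, hc⟩ : l ^ 2 ∣ Nat.card G := hcard 0 ▸ Subgroup.card_subgroup_dvd_card _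
    rw [hc] at hcount
    have h1 : l * c + 2 = l * 3 := Nat.eq_of_mul_eq_mul_left hprime.pos (by linarith)
    exact (Nat.prime_dvd_prime_iff_eq hprime Nat.prime_two).1
      ((Nat.dvd_add_right (Dvd.intro c rfl)).1 (h1 ▸ Dvd.intro 3 rfl))
  have hG : Nat.card G = 8 := by
    rw [hl2] at hcount
    omega
  have horder : ∀ y, y ∉ S none → orderOf y = 4 := by
    intro y hy
    obtain ⟨i, hi⟩ := hcov y hy
    rw [← Nat.card_zpowers, hi, hcard, hl2]
    norm_num
  -- Both squares are nontrivial elements of `S none`, which has order two.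
  have hsq_eq : ∀ y z, y ∉ S none → z ∉ S none → y ^ 2 = z ^ 2 := by
    have hmem : ∀ y, y ∉ S none → y ^ 2 ∈ S none ∧ y ^ 2 ≠ 1 := by
      intro y hy
      have h2 : orderOf (y ^ 2) = 2 := by
        rw [orderOf_pow_of_dvd two_ne_zero (by rw [horder y hy]; norm_num), horder y hy]
      refine ⟨?_, fun h1 => ?_⟩
      · by_contra h1
        rw [horder _ h1] at h2
        norm_num at h2
      · rw [h1, orderOf_one] at h2
        norm_num at h2
    intro y z hy hz
    obtain ⟨w, -, hw⟩ := (Nat.card_eq_two_iff' (1 : S none)).1 (hl.symm.trans hl2)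
    have h1 := hw ⟨y ^ 2, (hmem y hy).1⟩ fun h1 => (hmem y hy).2 (congrArg Subtype.val h1)
    have h2 := hw ⟨z ^ 2, (hmem z hz).1⟩ fun h2 => (hmem z hz).2 (congrArg Subtype.val h2)
    exact congrArg Subtype.val (h1.trans h2.symm)
  obtain ⟨a, ha, ha'⟩ := SetLike.exists_of_lt (hroot 0)
  obtain ⟨x, hx, hx'⟩ := SetLike.exists_of_lt (hroot 1)
  have hxa : x ∉ S (some 0) := fun h1 => hx' (hdisj 0 1 (by decide) ⟨h1, hx⟩)
  have hax : a * x ∉ S none := fun h1 =>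
    hxa ((Subgroup.mul_mem_cancel_left _ ha).1 ((hroot 0).le h1))
  -- Comparing the squares of ax and a gives x a x = a; together with x² = a² this shows that x
  -- inverts a.
  have h1 : a * (x * a * x) = a * a := by
    rw [← sq a, ← hsq_eq _ _ hax ha', sq]
    group
  have h2 : x * a * x = a := mul_left_cancel h1
  refine _root_.nonempty_mulEquiv_quaternionGroup (horder a ha') (hgen 0 a ha ha' ▸ hxa)
    (by rw [← sq]; exact hsq_eq _ _ hx' ha') ?_ hG
  calc x * a * x⁻¹ = x * a * x * (x ^ 2)⁻¹ := by group
    _ = a⁻¹ := by rw [h2, hsq_eq _ _ hx' ha']; group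

/-- In the dual order `S none` contains all other proper subgroups, so an element outside it
generates `G`. The product of `S (some 0)` with either other minimal subgroup is `S none`, so those
two have the same order, hence coincide in a cyclic group. -/
theorem IsSubgroupDiagram.not_starBelow_swap {G : Type*} [Group G] [Finite G]
    {r : Option (Fin 3) → Option (Fin 3) → Prop} {S : Option (Fin 3) → Subgroup G}
    (h : IsSubgroupDiagram r S) (hlt : ∀ s t, S s < S t ↔ StarBelow t s) : False := by
  have hle := h.le_iff hlt
  have hne : ∀ t, S t ≠ ⊥ ∧ S t ≠ ⊤ := fun t => (h.range_iff _).2 ⟨t, rfl⟩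
  have hroot : ∀ t, S t ≤ S none := fun t => (hle _ _).2 (by
    rcases t with _ | i
    · exact Or.inl rfl
    · exact Or.inr ⟨rfl, by simp⟩)
  have hbelow : ∀ t i, S t ≤ S (some i) → t = some i := by
    intro t i ht
    rcases (hle _ _).1 ht with h1 | ⟨h1, -⟩
    · exact h1
    · cases h1
  obtain ⟨x, hx⟩ : ∃ x, x ∉ S none := by
    by_contra! hall
    exact (hne none).2 ((Subgroup.eq_top_iff' _).2 hall)
  have htop : Subgroup.zpowers x = ⊤ := by
    rcases h.eq_bot_or_eq_top_or (Subgroup.zpowers x) with h1 | h1 | ⟨t, ht⟩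
    · exact absurd ((Subgroup.zpowers_eq_bot.1 h1) ▸ one_mem _) hx
    · exact h1
    · exact absurd (hroot t (ht ▸ Subgroup.mem_zpowers x)) hx
  have hcomm : ∀ u v : G, u * v = v * u := by
    intro u v
    obtain ⟨i, rfl⟩ := Subgroup.mem_zpowers_iff.1 (htop ▸ Subgroup.mem_top u)
    obtain ⟨j, rfl⟩ := Subgroup.mem_zpowers_iff.1 (htop ▸ Subgroup.mem_top v)
    exact zpow_mul_comm x i j
  have hnormal : (S (some 0)).Normal := ⟨fun u hu g => by
    rw [hcomm g u, mul_inv_cancel_right]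
    exact hu⟩
  have hcard : ∀ i, i ≠ 0 → Nat.card (S none) = Nat.card (S (some 0)) * Nat.card (S (some i)) := by
    intro i hi
    rw [← Subgroup.card_sup_of_inf_eq_bot]
    · rcases h.eq_bot_or_eq_top_or (S (some 0) ⊔ S (some i)) with h1 | h1 | ⟨t, ht⟩
      · exact absurd (eq_bot_iff.2 (le_sup_left.trans h1.le)) (hne _).1
      · exact absurd (eq_top_iff.2 (h1.ge.trans (sup_le (hroot _) (hroot _)))) (hne none).2
      · rcases t with _ | j
        · rw [ht]
        · have h2 := (hbelow _ j (le_sup_left.trans ht.ge)).trans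
            (hbelow _ j (le_sup_right.trans ht.ge)).symm
          exact absurd (Option.some_injective _ h2).symm hi
    · rcases h.eq_bot_or_eq_top_or (S (some 0) ⊓ S (some i)) with h1 | h1 | ⟨t, ht⟩
      · exact h1
      · exact absurd (eq_top_iff.2 (h1.ge.trans inf_le_left)) (hne _).2
      · have h2 := (hbelow t 0 (ht.le.trans inf_le_left)).symm.trans
          (hbelow t i (ht.le.trans inf_le_right))
        exact absurd (Option.some_injective _ h2).symm hi
  have h12 := Nat.eq_of_mul_eq_mul_left Nat.card_pos
    ((hcard 1 (by decide)).symm.trans (hcard 2 (by decide)))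
  have h3 := h.injective
    (Subgroup.eq_of_card_eq_of_le_zpowers (x := x) (htop ▸ le_top) (htop ▸ le_top) h12)
  exact absurd h3 (by decide)

theorem IsSubgroupDiagram.nonempty_mulEquiv_quaternionGroup {G : Type*} [Group G]
    {S : Option (Fin 3) → Subgroup G} (h : IsSubgroupDiagram StarBelow S) :
    Nonempty (G ≃* QuaternionGroup 2) := by
  have := h.finite
  rcases (h.comparable_iff none (some 0)).2 (Or.inl ⟨rfl, by simp⟩) with h1 | h1
  · exact h.quaternion_of_starBelow (iff_starBelow_of_none_some (L := fun s t => S s < S t)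
      (fun _ _ _ => lt_trans) (fun _ => lt_irrefl _) h.comparable_iff h1)
  · refine (h.not_starBelow_swap fun s t => ?_).elim
    exact iff_starBelow_of_none_some (L := fun s t => S t < S s) (fun _ _ _ h1 h2 => h2.trans h1)
      (fun _ => lt_irrefl _) (fun s t => or_comm.trans (h.comparable_iff s t)) h1 t s

theorem mainTheorem9 (G : Type*) [Group G] :
    (Nonempty (inclusionGraph G ≃g inclusionGraph Q8) → Nonempty (G ≃* Q8)) ∧
    (Nonempty (inclusionGraph G ≃g inclusionGraph M8) → Nonempty (G ≃* M8)) ∧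
    (∀ φ : Multiplicative (ZMod 2) →* MulAut (Multiplicative (ZMod 9)), φ ≠ 1 →
      Nonempty (inclusionGraph G ≃g
        inclusionGraph (Multiplicative (ZMod 9) ⋊[φ] Multiplicative (ZMod 2))) →
      Nonempty (G ≃* Multiplicative (ZMod 9) ⋊[φ] Multiplicative (ZMod 2))) := by
  refine ⟨?_, ?_, ?_⟩
  · rintro ⟨e⟩
    obtain ⟨S, hS⟩ := QuaternionGroup.isSubgroupDiagram_starSubgroup.transport e
    exact hS.nonempty_mulEquiv_quaternionGroup
  · rintro ⟨e⟩
    obtain ⟨S, hS⟩ := DihedralGroup.isSubgroupDiagram_four.transport e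
    exact hS.nonempty_mulEquiv_dihedralGroup (p := 2) (ZMod.castHom_surjective _) (by decide)
      (Or.inl rfl) (by simp)
  · rintro φ hφ ⟨e⟩
    obtain ⟨f⟩ := nonempty_semidirectProduct_mulEquiv_dihedralGroup φ hφ
    obtain ⟨S, hS⟩ := (DihedralGroup.isSubgroupDiagram_nine.map_mulEquiv f.symm).transport e
    obtain ⟨g⟩ := hS.nonempty_mulEquiv_dihedralGroup (p := 3) (ZMod.castHom_surjective _)
      (by decide) (Or.inr rfl) (by simp)
    exact ⟨g.trans f.symm⟩
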